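/- Let $f\ge 1$ be an integer with prime factorization $f=\prod_{i=1}^r p_i^{e_i}$, let $q_i=p_i^{e_i}$, and let $\mathcal{Q}$ be the set of the $2^r$ products of some of the $q_i$ (including the empty product $1$ and $f$ itself). Let $K=\mathbf{Q}(\zeta_f)$ be the $f$-th cyclotomic field, where $\zeta_f$ is a primitive $f$-th root of unity, and let $G=(\mathbf{Z}/f\mathbf{Z})^\times/\{-1,+1\}$. For $\alpha\in(\mathbf{Z}/f\mathbf{Z})^\times$ let $\sigma_\alpha:K\to\mathbf{C}$ be the field embedding with $\sigma_\alpha(\zeta_f)=e^{2\pi i\alpha/f}$; since $\sigma_{-\alpha}=\overline{\sigma_\alpha}$, the number $|\sigma_\alpha(x)|$ depends only on the class of $\alpha$ in $G$. For $x\in K$ put \[ \mathrm{Log}(x)=\sum_{\alpha\in G}\log_2|\sigma_\alpha(x)|\,\alpha\in\mathbf{R}[G], \] with the convention $\log_2 0=0$ (which only matters below when $e=f$). Let $c>1$ be a divisor of $f$ and let $\chi$ be an even Dirichlet character of conductor $c$, regarded as a primitive character modulo $c$ (so $\chi(p)=0$ for primes $p\mid c$). It induces the character $\alpha\mapsto\chi(\alpha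 \bmod c)$ of $G$, which we extend $\mathbf{R}$-linearly to $\chi:\mathbf{R}[G]\to\mathbf{C}$. Let $e\in\mathcal{Q}$. If $\gcd(c,e)=1$, then \[ \bigl|\chi(\mathrm{Log}(\zeta_f^e-1))\bigr|=\frac{\varphi(e)\sqrt{c}}{2\ln 2}\Bigl(\prod_{i:\ p_i\mid f/e}|1-\chi(p_i)|\Bigr)|L(1,\chi)|, \] where $\varphi$ is Euler's totient function and $L(s,\chi)$ is the Dirichlet $L$-function of $\chi$. If $\gcd(c,e)>1$, then $\chi(\mathrm{Log}(\zeta_f^e-1))=0$. -/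

import Mathlib

noncomputable section

namespace CycloLog

/-- The group `G = (ℤ/fℤ)ˣ / {-1, +1}`. -/
abbrev G (f : ℕ) : Type := (ZMod f)ˣ ⧸ Subgroup.zpowers (-1 : (ZMod f)ˣ)

/-- The complex number `exp(2πiα/f)` for `α ∈ (ℤ/fℤ)ˣ`. -/
def expRoot (f : ℕ) (α : (ZMod f)ˣ) : ℂ :=
  Complex.exp (2 * Real.pi * Complex.I * (((α : ZMod f).val : ℂ) / (f : ℂ)))

theorem expRoot_isPrimitiveRoot (f : ℕ) [NeZero f] (α : (ZMod f)ˣ) :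
    IsPrimitiveRoot (expRoot f α) f :=
  Complex.isPrimitiveRoot_exp_of_coprime _ _ (NeZero.ne f) (ZMod.val_coe_unit_coprime α)

section Embeddings

variable {f : ℕ} [NeZero f] {K : Type*} [Field K] [CharZero K] [IsCyclotomicExtension {f} ℚ K]
  {ζ : K}

/-- The field embedding `σ_α : K → ℂ`, `α ∈ (ℤ/fℤ)ˣ`, of the `f`-th cyclotomic field
`K = ℚ(ζ)`: the unique one with `σ_α(ζ) = exp(2πiα/f)`. -/
def sigma (hζ : IsPrimitiveRoot ζ f) (α : (ZMod f)ˣ) : K →ₐ[ℚ] ℂ :=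
  (hζ.embeddingsEquivPrimitiveRoots ℂ
    (Polynomial.cyclotomic.irreducible_rat (NeZero.pos f))).symm
    ⟨expRoot f α, (mem_primitiveRoots (NeZero.pos f)).2 (expRoot_isPrimitiveRoot f α)⟩

theorem sigma_zeta (hζ : IsPrimitiveRoot ζ f) (α : (ZMod f)ˣ) :
    sigma hζ α ζ = expRoot f α := by
  rw [← hζ.embeddingsEquivPrimitiveRoots_apply_coe ℂ
    (Polynomial.cyclotomic.irreducible_rat (NeZero.pos f)), sigma, Equiv.apply_symm_apply]

theorem expRoot_neg (α : (ZMod f)ˣ) : expRoot f (-α) = starRingEnd ℂ (expRoot f α) := by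
  have h : ∀ β : (ZMod f)ˣ, expRoot f β = ZMod.stdAddChar (β : ZMod f) := by
    intro β
    rw [ZMod.stdAddChar_apply, ZMod.toCircle_apply, expRoot]
    congr 1
    ring
  rw [h, h, Units.val_neg, AddChar.map_neg_eq_conj]

theorem sigma_neg (hζ : IsPrimitiveRoot ζ f) (α : (ZMod f)ˣ) (x : K) :
    sigma hζ (-α) x = starRingEnd ℂ (sigma hζ α x) := by
  have h : sigma hζ (-α) = (Complex.conjAe.toAlgHom.restrictScalars ℚ).comp (sigma hζ α) := by
    refine (hζ.powerBasis ℚ).algHom_ext ?_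
    rw [IsPrimitiveRoot.powerBasis_gen]
    change sigma hζ (-α) ζ = starRingEnd ℂ (sigma hζ α ζ)
    rw [sigma_zeta, sigma_zeta, expRoot_neg]
  rw [h]
  rfl

/-- The coordinate `log |σ_α(x)|` (binary logarithm) of the logarithmic embedding at the class
of `α` in `G`; it is well defined since `σ_{-α}` is the complex conjugate of `σ_α`. -/
def logCoord (hζ : IsPrimitiveRoot ζ f) (x : K) : G f → ℝ :=
  Quotient.lift (fun α : (ZMod f)ˣ => Real.logb 2 ‖sigma hζ α x‖) (by
    intro α β h
    have h' : α⁻¹ * β ∈ Subgroup.zpowers (-1 : (ZMod f)ˣ) := QuotientGroup.leftRel_apply.1 h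
    obtain ⟨k, hk⟩ := Subgroup.mem_zpowers_iff.1 h'
    have hβ : β = α * (-1) ^ k := by rw [hk, mul_inv_cancel_left]
    rcases Int.even_or_odd k with he | ho
    · rw [hβ, he.neg_one_zpow, mul_one]
    · have h1 : β = -α := by
        rw [hβ, ho.neg_one_zpow, mul_neg, mul_one]
      change Real.logb 2 ‖sigma hζ α x‖ = Real.logb 2 ‖sigma hζ β x‖
      rw [h1, sigma_neg, RCLike.norm_conj])

/-- The logarithmic embedding `Log : K → ℝ^G = ℝ[G]`,
`Log(x) = ∑_{α ∈ G} log |σ_α(x)| · α`. -/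
def Log (hζ : IsPrimitiveRoot ζ f) (x : K) : MonoidAlgebra ℝ (G f) :=
  ∑ α : G f, MonoidAlgebra.single α (logCoord hζ x α)

end Embeddings

/-- The character of `G = (ℤ/fℤ)ˣ / {-1, +1}` induced by an even Dirichlet character modulo a
divisor `c` of `f`, namely `α ↦ χ(α mod c)`. -/
def charOnG {c f : ℕ} (hcf : c ∣ f) (χ : DirichletCharacter ℂ c) (heven : χ.Even) :
    G f →* ℂ :=
  QuotientGroup.lift (Subgroup.zpowers (-1 : (ZMod f)ˣ))
    ((χ : ZMod c →* ℂ).comp ((Units.coeHom (ZMod c)).comp (ZMod.unitsMap hcf))) (by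
      rw [Subgroup.zpowers_le, MonoidHom.mem_ker]
      change χ ((ZMod.unitsMap hcf (-1) : (ZMod c)ˣ) : ZMod c) = 1
      rw [ZMod.unitsMap_val]
      have h : χ (-1) = 1 := heven
      simpa [ZMod.cast_neg hcf, ZMod.cast_one hcf] using h)

/-- The evaluation of an even Dirichlet character at an element of the group ring `ℝ[G]`:
the `ℝ`-linear (ring homomorphism) extension of the character of `G` it induces. -/
def charEval {c f : ℕ} (hcf : c ∣ f) (χ : DirichletCharacter ℂ c) (heven : χ.Even) :
    MonoidAlgebra ℝ (G f) →ₐ[ℝ] ℂ :=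
  MonoidAlgebra.lift ℝ ℂ (G f) (charOnG hcf χ heven)

/-- For `f = ∏ q_i` with `q_i = p_i ^ e_i` the prime power decomposition, the set of all
products of some of the `q_i`. -/
def Q (f : ℕ) : Finset ℕ :=
  f.primeFactors.powerset.image fun S => ∏ p ∈ S, p ^ f.factorization p

end CycloLog

end

/-! ### The exponential zeta function at `s = 1`. -/

section ExpZeta

open Complex Filter Topology Asymptotics Set HurwitzZeta

/-! Put `m = f / e`, which is coprime to `e`. The conjugates of `ζ ^ e` are primitive `m`-th roots
of unity, so `|σ_α(ζ ^ e - 1)|` depends only on `α mod m`.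

If `c ∤ m`, then `χ` is nontrivial on the kernel of reduction mod `m`, and translating by a kernel
element kills the sum (`charEval_Log_eq_zero`).

If `c ∣ m`, the kernel contributes the factor `φ(e)`, leaving a sum of `χ(i) log|1 - exp(2πii/m)|`
over `i` prime to `m`. Inclusion-exclusion on the primes of `m` and the distribution relation from
`1 - y ^ k = ∏ (1 - ω ^ j y)` reduce it to the full sum mod `c` times `∏ (1 - χ(p))`
(`sum_range_coprime_logNormOneSubExp`). That sum has absolute value `√c |L(1, χ)|`
(`Even.norm_sum_mul_log`), by the discrete Fourier transform, `|gaussSum| = √c` and `expZeta a 1 =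
-log (1 - z)`. The 2 in the denominator comes from passing to `G`. -/

theorem Complex.one_sub_mul_exp_neg_mem_slitPlane {z : ℂ} (hz : ‖z‖ = 1) (hz1 : z ≠ 1) {t : ℝ}
    (ht : 0 ≤ t) : 1 - z * Real.exp (-t) ∈ slitPlane := by
  left
  have hre : z.re < 1 := by
    refine lt_of_le_of_ne (hz ▸ re_le_norm z) fun h => hz1 ?_
    have h2 : z.re * z.re + z.im * z.im = 1 := by
      rw [← normSq_apply, normSq_eq_norm_sq, hz, one_pow]
    apply Complex.ext <;> simp only [one_re, one_im, h]
    nlinarith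
  have h0 : 0 < Real.exp (-t) := Real.exp_pos _
  have h1 : Real.exp (-t) ≤ 1 := Real.exp_le_one_iff.2 (by linarith)
  simp only [sub_re, one_re, mul_re, ofReal_re, ofReal_im, mul_zero, sub_zero]
  nlinarith

theorem Complex.hasDerivAt_log_one_sub_mul_exp_neg {z : ℂ} (hz : ‖z‖ = 1) (hz1 : z ≠ 1) {t : ℝ}
    (ht : 0 ≤ t) : HasDerivAt (fun t : ℝ => log (1 - z * Real.exp (-t)))
      (z * Real.exp (-t) / (1 - z * Real.exp (-t))) t := by
  have h1 : HasDerivAt (fun t : ℝ => 1 - z * (Real.exp (-t) : ℂ)) (z * Real.exp (-t)) t := by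
    have h : HasDerivAt (fun t : ℝ => Real.exp (-t)) (-Real.exp (-t)) t := by
      simpa using (hasDerivAt_neg t).exp
    simpa using (h.ofReal_comp.const_mul z).const_sub 1
  exact h1.clog_real (one_sub_mul_exp_neg_mem_slitPlane hz hz1 ht)

/-- For `re s > 1`, expanding `F` geometrically shows that its Mellin transform is `Gamma s *
expZeta a s`. Both sides are continuous at 1, and there the transform is `∫ F`, with antiderivative
`log (1 - z e^{-t})`. This avoids summing a conditionally convergent series. -/
theorem HurwitzZeta.expZeta_one {a : ℝ} (ha : (a : UnitAddCircle) ≠ 0)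
    (hz1 : cexp (2 * Real.pi * I * a) ≠ 1) :
    expZeta a 1 = -log (1 - cexp (2 * Real.pi * I * a)) := by
  set z := cexp (2 * Real.pi * I * a) with hzdef
  have hz : ‖z‖ = 1 := by
    rw [hzdef, show 2 * (Real.pi : ℂ) * I * a = ((2 * Real.pi * a : ℝ) : ℂ) * I by push_cast; ring,
      norm_exp_ofReal_mul_I]
  let F : ℝ → ℂ := fun t => z * Real.exp (-t) / (1 - z * Real.exp (-t))
  have hslit {t : ℝ} (ht : 0 ≤ t) : 1 - z * (Real.exp (-t) : ℂ) ∈ slitPlane :=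
    one_sub_mul_exp_neg_mem_slitPlane hz hz1 ht
  have hden : Tendsto (fun t : ℝ => 1 - z * (Real.exp (-t) : ℂ)) atTop (𝓝 1) := by
    have h := (continuous_ofReal.tendsto 0).comp Real.tendsto_exp_neg_atTop_nhds_zero
    simpa [Function.comp_def] using (h.const_mul z).const_sub 1
  have hcont : ContinuousOn F (Ici 0) := by
    refine ContinuousOn.div (by fun_prop) (by fun_prop) fun t ht => slitPlane_ne_zero (hslit ht)
  have htop : F =O[atTop] fun t => Real.exp (-1 * t) := by
    have h1 : (fun t : ℝ => z * (Real.exp (-t) : ℂ)) =O[atTop] fun t => Real.exp (-1 * t) := by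
      refine IsBigO.of_bound 1 (Eventually.of_forall fun t => ?_)
      rw [norm_mul, hz, norm_real, neg_one_mul]
    have h2 : (fun t : ℝ => (1 - z * (Real.exp (-t) : ℂ))⁻¹) =O[atTop] fun _ => (1 : ℝ) :=
      (hden.inv₀ one_ne_zero).isBigO_one ℝ
    simpa [F, div_eq_mul_inv] using h1.mul h2
  -- `F` stays bounded at 0 because `z ≠ 1`, so the transform already converges for `re s > 0`.
  have hbot : F =O[𝓝[>] 0] fun t : ℝ => t ^ (-(0 : ℝ)) := by
    simp only [neg_zero, Real.rpow_zero]
    exact (((hcont 0 self_mem_Ici).mono Ioi_subset_Ici_self).tendsto).isBigO_one ℝ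
  have hmel : ContinuousAt (mellin F) 1 :=
    (mellin_differentiableAt_of_isBigO_rpow_exp one_pos
      ((hcont.mono Ioi_subset_Ici_self).locallyIntegrableOn measurableSet_Ioi) htop hbot
      (by simp)).continuousAt
  have hexp : ContinuousAt (fun s => Gamma s * expZeta a s) 1 := by
    refine ContinuousAt.mul ?_ (differentiableAt_expZeta a 1 (Or.inr ha)).continuousAt
    refine (differentiableAt_Gamma 1 fun m h => ?_).continuousAt
    have := congr_arg re h
    simp at this
    have : (0 : ℝ) ≤ m := m.cast_nonneg
    linarith
  have heq (s : ℂ) (hs : 1 < s.re) : mellin F s = Gamma s * expZeta a s := by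
    have hs0 : s ≠ 0 := by
      rintro rfl
      simp at hs
      linarith
    have h1 : HasSum (fun n : ℕ => Gamma s * z ^ (n + 1) / ((n + 1 : ℝ) : ℂ) ^ s)
        (mellin F s) := by
      refine hasSum_mellin (fun n => Or.inr (by positivity)) (by linarith) (fun t ht => ?_) ?_
      · have hw : ‖z * (Real.exp (-t) : ℂ)‖ < 1 := by
          rw [norm_mul, hz, norm_real, one_mul, Real.norm_eq_abs, Real.abs_exp]
          rw [Real.exp_lt_one_iff]
          simpa using ht
        have h := (hasSum_geometric_of_norm_lt_one hw).mul_left (z * (Real.exp (-t) : ℂ))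
        rw [← div_eq_mul_inv] at h
        refine h.congr_fun fun n => ?_
        rw [← pow_succ', mul_pow, ← ofReal_pow, ← Real.exp_nat_mul]
        push_cast
        ring_nf
      · simp only [norm_pow, hz, one_pow]
        exact_mod_cast (summable_nat_add_iff 1).2 (Real.summable_one_div_nat_rpow.2 hs)
    have h2 := ((hasSum_nat_add_iff' 1).2 (hasSum_expZeta_of_one_lt_re a hs)).mul_left (Gamma s)
    simp only [Finset.sum_range_one, Nat.cast_zero, zero_cpow hs0, div_zero, sub_zero] at h2
    refine h1.unique (h2.congr_fun fun n => ?_)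
    rw [hzdef, ← Complex.exp_nat_mul, mul_div_assoc]
    push_cast
    ring_nf
  have hseq : Tendsto (fun n : ℕ => 1 + 1 / ((n : ℂ) + 1)) atTop (𝓝 1) := by
    simpa using (tendsto_one_div_add_atTop_nhds_zero_nat (𝕜 := ℂ)).const_add 1
  have h1 : mellin F 1 = expZeta a 1 := by
    have h := tendsto_nhds_unique (hmel.tendsto.comp hseq)
      ((hexp.tendsto.comp hseq).congr fun n => (heq _ ?_).symm)
    · rwa [Gamma_one, one_mul] at h
    · have : (1 : ℂ) + 1 / ((n : ℂ) + 1) = ((1 + 1 / ((n : ℝ) + 1) : ℝ) : ℂ) := by push_cast; rfl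
      rw [this, ofReal_re]
      have : 0 < 1 / ((n : ℝ) + 1) := by positivity
      linarith
  have hint : MellinConvergent F 1 :=
    mellinConvergent_of_isBigO_rpow_exp one_pos
      ((hcont.mono Ioi_subset_Ici_self).locallyIntegrableOn measurableSet_Ioi) htop hbot (by simp)
  simp only [MellinConvergent, sub_self, cpow_zero, one_smul] at hint
  rw [← h1, mellin]
  simp only [sub_self, cpow_zero, one_smul]
  have hlim : Tendsto (fun t : ℝ => log (1 - z * (Real.exp (-t) : ℂ))) atTop (𝓝 0) := by
    simpa using hden.clog one_mem_slitPlane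
  rw [MeasureTheory.integral_Ioi_of_hasDerivAt_of_tendsto'
    (fun t ht => hasDerivAt_log_one_sub_mul_exp_neg hz hz1 ht)
    hint hlim]
  simp

end ExpZeta

/-! ### Gauss sums and `L(1, χ)` for even characters. -/

section LValue

open Complex ZMod HurwitzZeta

theorem Complex.log_one_sub_add_log_one_sub_inv {z : ℂ} (hz : ‖z‖ = 1) (hz1 : z ≠ 1) :
    log (1 - z) + log (1 - z⁻¹) = 2 * (Real.log ‖1 - z‖ : ℂ) := by
  have hs : 1 - z ∈ slitPlane := by
    simpa using one_sub_mul_exp_neg_mem_slitPlane hz hz1 le_rfl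
  rw [inv_eq_conj hz, show 1 - (starRingEnd ℂ) z = (starRingEnd ℂ) (1 - z) by simp,
    log_conj _ (slitPlane_arg_ne_pi hs), add_conj, log_re]
  push_cast
  ring

variable {c : ℕ} [NeZero c]

theorem ZMod.expZeta_toAddCircle_one {j : ZMod c} (hj : j ≠ 0) :
    expZeta (toAddCircle j) 1 = -log (1 - stdAddChar j) := by
  have h : cexp (2 * Real.pi * I * ((j.val / c : ℝ) : ℂ)) = stdAddChar j := by
    rw [stdAddChar_apply, toCircle_apply]
    push_cast
    ring_nf
  rw [toAddCircle_apply, expZeta_one, h]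
  · rwa [← toAddCircle_apply, Ne, toAddCircle_eq_zero]
  · rw [h]
    exact fun h => hj (injective_stdAddChar (h.trans (AddChar.map_zero_eq_one _).symm))

theorem ZMod.norm_stdAddChar (j : ZMod c) : ‖stdAddChar j‖ = 1 := by
  rw [stdAddChar_apply, Circle.norm_coe]

namespace DirichletCharacter

theorem IsPrimitive.inv {c : ℕ} {χ : DirichletCharacter ℂ c} (hχ : χ.IsPrimitive) :
    χ⁻¹.IsPrimitive := by
  rw [isPrimitive_def, conductor_inv]
  exact hχ

theorem Even.inv {c : ℕ} {χ : DirichletCharacter ℂ c} (hχ : χ.Even) : χ⁻¹.Even := by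
  have h : χ (-1) = 1 := hχ
  change χ⁻¹ (-1) = 1
  rw [MulChar.inv_apply_eq_inv, h, Ring.inverse_one]

variable {χ : DirichletCharacter ℂ c}

theorem Even.dft_eq (hχ : χ.IsPrimitive) (heven : χ.Even) :
    𝓕 χ = fun k => gaussSum χ stdAddChar * χ⁻¹ k := by
  ext k
  rw [hχ.fourierTransform_eq_inv_mul_gaussSum, heven.inv.eval_neg, mul_comm]

/-- Fourier inversion: apply the transform twice and evaluate at 1. -/
theorem Even.gaussSum_mul_gaussSum_inv (hχ : χ.IsPrimitive) (heven : χ.Even) :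
    gaussSum χ stdAddChar * gaussSum χ⁻¹ stdAddChar = c := by
  have h := congr_fun (dft_dft (χ : ZMod c → ℂ)) 1
  rw [heven.dft_eq hχ, dft_const_mul, heven.inv.dft_eq hχ.inv, inv_inv] at h
  simpa [heven.eval_neg] using h

theorem Even.gaussSum_inv (heven : χ.Even) :
    gaussSum χ⁻¹ stdAddChar = starRingEnd ℂ (gaussSum χ stdAddChar) := by
  simp only [gaussSum, map_sum, map_mul]
  rw [← Equiv.sum_comp (Equiv.neg (ZMod c))]
  refine Finset.sum_congr rfl fun j _ => ?_
  rw [Equiv.neg_apply, heven.inv.eval_neg, AddChar.map_neg_eq_conj, ← MulChar.star_apply']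
  rfl

theorem Even.norm_gaussSum (hχ : χ.IsPrimitive) (heven : χ.Even) :
    ‖gaussSum χ stdAddChar‖ = √(c : ℝ) := by
  have h := heven.gaussSum_mul_gaussSum_inv hχ
  rw [heven.gaussSum_inv, mul_conj, normSq_eq_norm_sq] at h
  rw [eq_comm, Real.sqrt_eq_iff_eq_sq (by positivity) (norm_nonneg _)]
  exact_mod_cast h.symm

theorem Even.gaussSum_mul_LFunction_inv_one (hc : c ≠ 1) (hχ : χ.IsPrimitive) (heven : χ.Even) :
    gaussSum χ stdAddChar * LFunction χ⁻¹ 1 =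
      -∑ j : ZMod c, χ j * (Real.log ‖1 - stdAddChar j‖ : ℂ) := by
  have h0 : χ 0 = 0 := χ.map_zero' hc
  -- The `j = 0` term would have a pole at `s = 1`; `χ 0 = 0` removes it.
  have h := ZMod.LFunction_dft (χ : ZMod c → ℂ) (s := 1) (Or.inl h0)
  have h1 : ZMod.LFunction (𝓕 χ) 1 = gaussSum χ stdAddChar * LFunction χ⁻¹ 1 := by
    rw [heven.dft_eq hχ, DirichletCharacter.LFunction]
    simp only [ZMod.LFunction, Finset.mul_sum]
    exact Finset.sum_congr rfl fun _ _ => by ring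
  have h2 : ∑ j : ZMod c, χ j * expZeta (toAddCircle (-j)) 1 =
      ∑ j : ZMod c, χ j * expZeta (toAddCircle j) 1 := by
    rw [← Equiv.sum_comp (Equiv.neg (ZMod c))]
    exact Finset.sum_congr rfl fun j _ => by rw [Equiv.neg_apply, heven.eval_neg, neg_neg]
  rw [h1] at h
  refine mul_left_cancel₀ (two_ne_zero' ℂ) ?_
  rw [two_mul, h]
  -- One copy keeps `-j` and the other has `j`: adding conjugate logarithms leaves twice the real
  -- part.
  nth_rw 2 [h2]
  rw [← Finset.sum_add_distrib, ← Finset.sum_neg_distrib, Finset.mul_sum]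
  refine Finset.sum_congr rfl fun j _ => ?_
  rcases eq_or_ne j 0 with rfl | hj
  · rw [h0]
    ring
  have hne : stdAddChar j ≠ 1 := fun h =>
    hj (injective_stdAddChar (h.trans (AddChar.map_zero_eq_one _).symm))
  have h3 := log_one_sub_add_log_one_sub_inv (norm_stdAddChar j) hne
  rw [expZeta_toAddCircle_one hj, expZeta_toAddCircle_one (neg_ne_zero.2 hj),
    AddChar.map_neg_eq_inv]
  linear_combination (-χ j) * h3

theorem Even.norm_sum_mul_log (hc : c ≠ 1) (hχ : χ.IsPrimitive) (heven : χ.Even) :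
    ‖∑ j : ZMod c, χ j * (Real.log ‖1 - stdAddChar j‖ : ℂ)‖ = √(c : ℝ) * ‖LFunction χ 1‖ := by
  have h := heven.inv.gaussSum_mul_LFunction_inv_one hc hχ.inv
  rw [inv_inv] at h
  have h1 : ∑ j : ZMod c, χ⁻¹ j * (Real.log ‖1 - stdAddChar j‖ : ℂ) =
      starRingEnd ℂ (∑ j : ZMod c, χ j * (Real.log ‖1 - stdAddChar j‖ : ℂ)) := by
    simp only [map_sum, map_mul, conj_ofReal]
    exact Finset.sum_congr rfl fun j _ => by rw [← MulChar.star_apply']; rfl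
  rw [← heven.inv.norm_gaussSum hχ.inv, ← norm_mul, h, norm_neg, h1, RCLike.norm_conj]

end DirichletCharacter

end LValue

/-! ### Distribution relations and inclusion-exclusion. -/

section Distribution

open Complex

/-- The logarithm of the absolute value of `1 - exp(2πix)`. -/
noncomputable def logNormOneSubExp (x : ℝ) : ℝ := Real.log ‖1 - cexp (2 * Real.pi * I * x)‖

theorem logNormOneSubExp_natCast_div (n b : ℕ) [NeZero n] :
    logNormOneSubExp (b / n) = Real.log ‖1 - ZMod.stdAddChar (b : ZMod n)‖ := by
  have h := ZMod.stdAddChar_coe (N := n) b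
  rw [Int.cast_natCast] at h
  rw [logNormOneSubExp, h]
  push_cast
  ring_nf

theorem sum_logNormOneSubExp {k : ℕ} (hk : 0 < k) {x : ℝ} (hx : cexp (2 * Real.pi * I * x) ≠ 1) :
    ∑ j ∈ Finset.range k, logNormOneSubExp ((x + j) / k) = logNormOneSubExp x := by
  have hk0 : (k : ℂ) ≠ 0 := Nat.cast_ne_zero.2 hk.ne'
  have hζ := Complex.isPrimitiveRoot_exp k hk.ne'
  have hprod := hζ.pow_sub_pow_eq_prod_sub_mul 1 (cexp (2 * Real.pi * I * (x / k))) hk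
  have hpow : cexp (2 * Real.pi * I * (x / k)) ^ k = cexp (2 * Real.pi * I * x) := by
    rw [← Complex.exp_nat_mul]
    congr 1
    field_simp
  rw [one_pow, hpow] at hprod
  have hprod' : 1 - cexp (2 * Real.pi * I * x) =
      ∏ j ∈ Finset.range k, (1 - cexp (2 * Real.pi * I * (((x + j) / k : ℝ) : ℂ))) := by
    rw [hprod]
    symm
    refine Finset.prod_bij (fun j _ => cexp (2 * Real.pi * I / k) ^ j) (fun j _ => ?_)
      (fun i hi j hj h => hζ.pow_inj (Finset.mem_range.1 hi) (Finset.mem_range.1 hj) h)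
      (fun z hz => ?_) fun j _ => ?_
    · rw [Polynomial.mem_nthRootsFinset hk, pow_right_comm, hζ.pow_eq_one, one_pow]
    · have : NeZero k := ⟨hk.ne'⟩
      obtain ⟨i, hi, h⟩ := hζ.eq_pow_of_pow_eq_one ((Polynomial.mem_nthRootsFinset hk _).1 hz)
      exact ⟨i, Finset.mem_range.2 hi, h⟩
    · rw [← Complex.exp_nat_mul, ← Complex.exp_add]
      push_cast
      ring_nf
  unfold logNormOneSubExp
  have hne : ∏ j ∈ Finset.range k, (1 - cexp (2 * Real.pi * I * (((x + j) / k : ℝ) : ℂ))) ≠ 0 := by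
    rw [← hprod']
    exact sub_ne_zero.2 hx.symm
  rw [hprod', norm_prod, Real.log_prod]
  exact fun j hj => norm_ne_zero_iff.2 (Finset.prod_ne_zero_iff.1 hne j hj)

theorem Finset.sum_range_mul_eq {M : Type*} [AddCommMonoid M] (F : ℕ → M) (c k : ℕ) :
    ∑ i ∈ range (c * k), F i = ∑ b ∈ range c, ∑ j ∈ range k, F (b + c * j) := by
  rw [sum_comm]
  induction k with
  | zero => simp
  | succ k ih =>
    rw [mul_add_one, sum_range_add, ih, sum_range_succ]
    simp only [add_comm]

variable {c : ℕ} (χ : DirichletCharacter ℂ c)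

theorem DirichletCharacter.sum_range_mul_logNormOneSubExp (hc : 1 < c) {k : ℕ} (hk : 0 < k) :
    ∑ i ∈ Finset.range (c * k), χ i * (logNormOneSubExp (i / (c * k : ℕ)) : ℂ) =
      ∑ b ∈ Finset.range c, χ b * (logNormOneSubExp (b / c) : ℂ) := by
  have : NeZero c := ⟨by omega⟩
  have hc0 : (c : ℝ) ≠ 0 := NeZero.ne _
  rw [Finset.sum_range_mul_eq]
  refine Finset.sum_congr rfl fun b hb => ?_
  -- The distribution relation is not available at `x = 0`, but `χ 0 = 0` there.
  rcases eq_or_ne b 0 with rfl | hb0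
  · have h0 : χ 0 = 0 := χ.map_zero' (by omega)
    simp [h0]
  have hx : cexp (2 * Real.pi * I * ((b / c : ℝ) : ℂ)) ≠ 1 := by
    intro h
    have h1 := (Complex.isPrimitiveRoot_exp c (NeZero.ne c)).pow_ne_one_of_pos_of_lt hb0
      (Finset.mem_range.1 hb)
    refine h1 ?_
    rw [← h, ← Complex.exp_nat_mul]
    push_cast
    ring_nf
  rw [← sum_logNormOneSubExp hk hx]
  push_cast
  rw [Finset.mul_sum]
  refine Finset.sum_congr rfl fun j _ => ?_
  have h1 : ((b : ZMod c) + c * j) = b := by simp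
  rw [h1, show ((b : ℝ) + c * j) / (c * k) = (b / c + j) / k by field_simp]

/-- If `d` is prime to `c`, then `c ∣ m / d`, and substituting `i = d * i'` gives a sum of level `m
/ d`. Otherwise both sides vanish. -/
theorem DirichletCharacter.sum_range_dvd_logNormOneSubExp (hc : 1 < c) {m d : ℕ} (hm : 0 < m)
    (hcm : c ∣ m) (hd : d ∣ m) :
    ∑ i ∈ Finset.range m with d ∣ i, χ i * (logNormOneSubExp (i / m) : ℂ) =
      χ d * ∑ b ∈ Finset.range c, χ b * (logNormOneSubExp (b / c) : ℂ) := by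
  by_cases hdc : IsUnit (d : ZMod c)
  · have hcop : c.Coprime d := ((ZMod.isUnit_iff_coprime d c).1 hdc).symm
    obtain ⟨n, rfl⟩ := hd
    obtain ⟨k, rfl⟩ := hcop.dvd_of_dvd_mul_left hcm
    have hd0 : 0 < d := Nat.pos_of_mul_pos_right hm
    have hk0 : 0 < k := by
      rcases Nat.eq_zero_or_pos k with rfl | h
      · simp at hm
      · exact h
    rw [← χ.sum_range_mul_logNormOneSubExp hc hk0, Finset.mul_sum]
    symm
    refine Finset.sum_bij (fun i _ => d * i) (fun i hi => ?_) (fun i _ j _ h => ?_)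
      (fun i hi => ?_) fun i _ => ?_
    · simp only [Finset.mem_filter, Finset.mem_range] at hi ⊢
      exact ⟨Nat.mul_lt_mul_of_pos_left hi hd0, dvd_mul_right _ _⟩
    · exact Nat.eq_of_mul_eq_mul_left hd0 h
    · simp only [Finset.mem_filter, Finset.mem_range] at hi ⊢
      obtain ⟨hi, j, rfl⟩ := hi
      exact ⟨j, Nat.lt_of_mul_lt_mul_left hi, rfl⟩
    · have hd1 : (d : ℝ) ≠ 0 := Nat.cast_ne_zero.2 hd0.ne'
      rw [Nat.cast_mul (α := ZMod c), map_mul, mul_assoc]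
      push_cast
      rw [mul_div_mul_left _ _ hd1]
  · rw [χ.map_nonunit hdc, zero_mul]
    refine Finset.sum_eq_zero fun i hi => ?_
    rw [χ.map_nonunit, zero_mul]
    obtain ⟨j, rfl⟩ := (Finset.mem_filter.1 hi).2
    rw [Nat.cast_mul]
    exact fun h => hdc (isUnit_of_mul_isUnit_left h)

theorem Nat.prod_primeFactors_one_sub_ite_dvd {R : Type*} [CommRing R] {m : ℕ} (hm : m ≠ 0)
    (b : ℕ) :
    ∏ p ∈ m.primeFactors, (1 + (-if p ∣ b then (1 : R) else 0)) =
      if m.Coprime b then 1 else 0 := by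
  split_ifs with h
  · refine Finset.prod_eq_one fun p hp => ?_
    rw [if_neg, neg_zero, add_zero]
    intro hpb
    have hpp := Nat.prime_of_mem_primeFactors hp
    exact hpp.one_lt.ne' (Nat.dvd_one.1 (h ▸ Nat.dvd_gcd (Nat.dvd_of_mem_primeFactors hp) hpb))
  · obtain ⟨p, hp, hpm, hpb⟩ := Nat.Prime.not_coprime_iff_dvd.1 h
    refine Finset.prod_eq_zero (hp.mem_primeFactors hpm hm) ?_
    rw [if_pos hpb, add_neg_cancel]

theorem Nat.prod_dvd_iff_of_prime {S : Finset ℕ} (hS : ∀ p ∈ S, p.Prime) (b : ℕ) :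
    ∏ p ∈ S, p ∣ b ↔ ∀ p ∈ S, p ∣ b := by
  refine ⟨fun h p hp => (Finset.dvd_prod_of_mem _ hp).trans h, fun h => ?_⟩
  exact Finset.prod_primes_dvd b (fun p hp => (hS p hp).prime) h

theorem DirichletCharacter.sum_range_coprime_logNormOneSubExp (hc : 1 < c) {m : ℕ} (hm : 0 < m)
    (hcm : c ∣ m) :
    ∑ i ∈ Finset.range m with m.Coprime i, χ i * (logNormOneSubExp (i / m) : ℂ) =
      (∏ p ∈ m.primeFactors, (1 - χ p)) *
        ∑ b ∈ Finset.range c, χ b * (logNormOneSubExp (b / c) : ℂ) := by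
  rw [Finset.sum_filter]
  calc
    _ = ∑ i ∈ Finset.range m, ∑ S ∈ m.primeFactors.powerset,
        (∏ _p ∈ S, (-1 : ℂ)) *
          if ∏ p ∈ S, p ∣ i then χ i * (logNormOneSubExp (i / m) : ℂ) else 0 := by
      refine Finset.sum_congr rfl fun i _ => ?_
      have h := Nat.prod_primeFactors_one_sub_ite_dvd (R := ℂ) hm.ne' i
      rw [Finset.prod_one_add] at h
      rw [← one_mul (χ _ * _), ← zero_mul (χ i * (logNormOneSubExp (i / m) : ℂ)), ← ite_mul, ← h,
        Finset.sum_mul]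
      refine Finset.sum_congr rfl fun S hS => ?_
      have hS' : ∀ p ∈ S, p.Prime := fun p hp =>
        Nat.prime_of_mem_primeFactors (Finset.mem_powerset.1 hS hp)
      simp only [Nat.prod_dvd_iff_of_prime hS']
      split_ifs with h
      · rw [one_mul]
        congr 1
        exact Finset.prod_congr rfl fun p hp => by rw [if_pos (h p hp)]
      · push Not at h
        obtain ⟨p, hp, hpi⟩ := h
        rw [Finset.prod_eq_zero hp (by rw [if_neg hpi, neg_zero])]
        simp
    _ = ∑ S ∈ m.primeFactors.powerset, (∏ p ∈ S, (-χ p)) *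
        ∑ b ∈ Finset.range c, χ b * (logNormOneSubExp (b / c) : ℂ) := by
      rw [Finset.sum_comm]
      refine Finset.sum_congr rfl fun S hS => ?_
      have hd : ∏ p ∈ S, p ∣ m :=
        (Finset.prod_dvd_prod_of_subset _ _ _ (Finset.mem_powerset.1 hS)).trans
          (Nat.prod_primeFactors_dvd m)
      rw [← Finset.mul_sum, ← Finset.sum_filter,
        χ.sum_range_dvd_logNormOneSubExp hc hm hcm hd, ← mul_assoc, Nat.cast_prod, map_prod,
        ← Finset.prod_mul_distrib]
      simp only [neg_one_mul]
    _ = _ := by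
      rw [← Finset.sum_mul, ← Finset.prod_one_add]
      simp only [sub_eq_add_neg]

end Distribution

/-! ### Sums over unit groups and kernels of reduction. -/

section UnitSums

theorem MonoidHom.sum_comp_of_surjective {G H M : Type*} [Group G] [Group H] [Fintype G] [Fintype H]
    [AddCommMonoid M] {φ : G →* H} (hφ : Function.Surjective φ) (F : H → M) :
    ∑ g, F (φ g) = Nat.card φ.ker • ∑ h, F h := by
  classical
  rw [← Finset.sum_fiberwise Finset.univ φ, Finset.smul_sum]
  refine Finset.sum_congr rfl fun h _ => ?_
  rw [Finset.sum_congr rfl (g := fun _ => F h) fun g hg => by rw [(Finset.mem_filter.1 hg).2],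
    Finset.sum_const, MonoidHom.card_fiber_eq_of_mem_range φ (hφ h) ⟨1, map_one φ⟩]
  congr 1
  rw [Nat.card_eq_fintype_card, Fintype.card_subtype]
  simp only [MonoidHom.mem_ker]

theorem ZMod.card_ker_unitsMap {f m : ℕ} [NeZero f] (hm : m ∣ f) (hcop : (f / m).Coprime m) :
    Nat.card (ZMod.unitsMap hm).ker = (f / m).totient := by
  have hm0 : 0 < m := Nat.pos_of_dvd_of_pos hm (NeZero.pos f)
  have : NeZero m := ⟨hm0.ne'⟩
  have h := (ZMod.unitsMap hm).ker.card_mul_index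
  rw [Subgroup.index_ker, MonoidHom.range_eq_top.2 (ZMod.unitsMap_surjective hm),
    Subgroup.card_top, Nat.card_eq_fintype_card (α := (ZMod f)ˣ),
    Nat.card_eq_fintype_card (α := (ZMod m)ˣ), ZMod.card_units_eq_totient,
    ZMod.card_units_eq_totient] at h
  have h2 := Nat.totient_mul hcop
  rw [Nat.div_mul_cancel hm, ← h] at h2
  exact Nat.eq_of_mul_eq_mul_right (Nat.totient_pos.2 hm0) h2

theorem ZMod.sum_units_eq_sum_range {m : ℕ} [NeZero m] {M : Type*} [AddCommMonoid M] (F : ℕ → M) :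
    ∑ u : (ZMod m)ˣ, F (u : ZMod m).val = ∑ i ∈ Finset.range m with m.Coprime i, F i := by
  refine Finset.sum_bij (fun u _ => (u : ZMod m).val) (fun u _ => ?_)
    (fun u _ v _ h => Units.ext (ZMod.val_injective m h)) (fun i hi => ?_) fun _ _ => rfl
  · simp only [Finset.mem_filter, Finset.mem_range]
    exact ⟨ZMod.val_lt _, (ZMod.val_coe_unit_coprime u).symm⟩
  · simp only [Finset.mem_filter, Finset.mem_range] at hi
    refine ⟨ZMod.unitOfCoprime i hi.2.symm, Finset.mem_univ _, ?_⟩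
    rw [ZMod.coe_unitOfCoprime, ZMod.val_cast_of_lt hi.1]

theorem ZMod.sum_eq_sum_range {m : ℕ} [NeZero m] {M : Type*} [AddCommMonoid M] (F : ℕ → M) :
    ∑ u : ZMod m, F u.val = ∑ i ∈ Finset.range m, F i := by
  refine Finset.sum_bij (fun u _ => u.val) (fun u _ => Finset.mem_range.2 (ZMod.val_lt _))
    (fun u _ v _ h => ZMod.val_injective m h) (fun i hi => ?_) fun _ _ => rfl
  exact ⟨i, Finset.mem_univ _, ZMod.val_cast_of_lt (Finset.mem_range.1 hi)⟩

theorem DirichletCharacter.IsPrimitive.two_lt {R : Type*} [CommRing R] {c : ℕ}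
    {χ : DirichletCharacter R c}
    (hχ : χ.IsPrimitive) (hc : 1 < c) : 2 < c := by
  refine lt_of_le_of_ne hc ?_
  rintro rfl
  have h1 : χ = 1 := by
    ext u
    rw [Subsingleton.elim u 1, Units.val_one, map_one, map_one]
  rw [h1, DirichletCharacter.isPrimitive_def, DirichletCharacter.conductor_one] at hχ
  omega

/-- Otherwise the character induced mod `f` factors through `m`, so its conductor `c` divides `m`.
-/
theorem DirichletCharacter.IsPrimitive.exists_mem_ker_unitsMap_apply_ne_one {R : Type*}
    [CommRing R] {c f m : ℕ} [NeZero f] {χ : DirichletCharacter R c} (hχ : χ.IsPrimitive)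
    (hcf : c ∣ f) (hmf : m ∣ f) (hcm : ¬ c ∣ m) :
    ∃ k ∈ (ZMod.unitsMap hmf).ker, χ (ZMod.unitsMap hcf k : ZMod c) ≠ 1 := by
  by_contra! h
  refine hcm ?_
  have h1 : (changeLevel hcf χ).FactorsThrough m := by
    rw [factorsThrough_iff_ker_unitsMap hmf]
    intro k hk
    rw [MonoidHom.mem_ker, changeLevel_toUnitHom, MonoidHom.comp_apply]
    ext
    rw [MulChar.coe_toUnitHom, h k hk, Units.val_one]
  have h2 := conductor_dvd_of_mem_conductorSet _ ((mem_conductorSet_iff _).2 h1)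
  rwa [conductor_changeLevel, hχ] at h2

end UnitSums

/-! ### Evaluating characters on `Log (ζ ^ e - 1)`. -/

namespace CycloLog

theorem dvd_and_coprime_of_mem_Q {f e : ℕ} (hf : f ≠ 0) (he : e ∈ Q f) :
    e ∣ f ∧ e.Coprime (f / e) := by
  classical
  obtain ⟨S, hS, rfl⟩ := Finset.mem_image.1 he
  have hS := Finset.mem_powerset.1 hS
  have hpos : 0 < ∏ p ∈ S, p ^ f.factorization p := Finset.prod_pos fun p hp =>
    pow_pos (Nat.prime_of_mem_primeFactors (hS hp)).pos _
  have hprod : (∏ p ∈ f.primeFactors \ S, p ^ f.factorization p) *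
      ∏ p ∈ S, p ^ f.factorization p = f := by
    rw [Finset.prod_sdiff hS]
    exact Nat.prod_factorization_pow_eq_self hf
  refine ⟨⟨_, ((mul_comm _ _).trans hprod).symm⟩, ?_⟩
  rw [Nat.div_eq_of_eq_mul_left hpos hprod.symm]
  refine Nat.Coprime.prod_left fun p hp => Nat.Coprime.prod_right fun q hq => ?_
  rw [Finset.mem_sdiff] at hq
  refine Nat.Coprime.pow _ _ ((Nat.coprime_primes (Nat.prime_of_mem_primeFactors (hS hp))
    (Nat.prime_of_mem_primeFactors hq.1)).2 ?_)
  rintro rfl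
  exact hq.2 hp

variable {f : ℕ} [NeZero f] {K : Type*} [Field K] [CharZero K] [IsCyclotomicExtension {f} ℚ K]
  {ζ : K} {c : ℕ}

theorem norm_sigma_zeta_pow_sub_one (hζ : IsPrimitiveRoot ζ f) {m : ℕ} [NeZero m] (hm : m ∣ f)
    (α : (ZMod f)ˣ) :
    ‖sigma hζ α (ζ ^ (f / m) - 1)‖ =
      ‖1 - ZMod.stdAddChar (ZMod.unitsMap hm α : ZMod m)‖ := by
  have h : sigma hζ α (ζ ^ (f / m)) = ZMod.stdAddChar (ZMod.unitsMap hm α : ZMod m) := by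
    have h1 := ZMod.stdAddChar_coe (N := m) ((α : ZMod f).val : ℤ)
    rw [Int.cast_natCast, ZMod.natCast_val] at h1
    rw [map_pow, sigma_zeta, ZMod.unitsMap_val, h1, expRoot, ← Complex.exp_nat_mul]
    congr 1
    have hm0 : (m : ℂ) ≠ 0 := NeZero.ne _
    have hf0 : (f : ℂ) ≠ 0 := NeZero.ne _
    rw [Nat.cast_div hm hm0]
    push_cast
    field_simp
  rw [map_sub, map_one, h, norm_sub_rev]

/-- Each class of `G` has exactly two representatives, as `-1 ≠ 1` when `f > 2`. -/
theorem two_mul_charEval_Log (hζ : IsPrimitiveRoot ζ f) (hf : 2 < f) (hcf : c ∣ f)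
    (χ : DirichletCharacter ℂ c) (heven : χ.Even) (x : K) :
    2 * charEval hcf χ heven (Log hζ x) = ∑ α : (ZMod f)ˣ,
      χ (ZMod.unitsMap hcf α : ZMod c) * (Real.logb 2 ‖sigma hζ α x‖ : ℂ) := by
  have hne : (-1 : (ZMod f)ˣ) ≠ 1 := by
    intro h
    have : Fact (2 < f) := ⟨hf⟩
    exact ZMod.neg_one_ne_one (congr_arg Units.val h)
  have hcard : Nat.card (QuotientGroup.mk' (Subgroup.zpowers (-1 : (ZMod f)ˣ))).ker = 2 := by
    rw [QuotientGroup.ker_mk', Nat.card_zpowers]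
    exact orderOf_eq_prime (by simp) hne
  have h := MonoidHom.sum_comp_of_surjective
    (QuotientGroup.mk'_surjective (Subgroup.zpowers (-1 : (ZMod f)ˣ)))
    fun α : G f => charOnG hcf χ heven α * (logCoord hζ x α : ℂ)
  rw [hcard, nsmul_eq_mul, Nat.cast_ofNat] at h
  rw [charEval, Log, map_sum]
  simp only [MonoidAlgebra.lift_single, Complex.real_smul]
  rw [Finset.sum_congr rfl fun α _ => mul_comm (logCoord hζ x α : ℂ) _, ← h]
  rfl

theorem charEval_Log_eq_zero (hζ : IsPrimitiveRoot ζ f) (hf : 2 < f) (hcf : c ∣ f)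
    {χ : DirichletCharacter ℂ c} (hχ : χ.IsPrimitive) (heven : χ.Even) {m : ℕ} [NeZero m]
    (hmf : m ∣ f) (hcm : ¬ c ∣ m) :
    charEval hcf χ heven (Log hζ (ζ ^ (f / m) - 1)) = 0 := by
  obtain ⟨k, hk, hne⟩ := hχ.exists_mem_ker_unitsMap_apply_ne_one hcf hmf hcm
  have h := two_mul_charEval_Log hζ hf hcf χ heven (ζ ^ (f / m) - 1)
  simp only [norm_sigma_zeta_pow_sub_one hζ hmf] at h
  set T := ∑ α : (ZMod f)ˣ, χ (ZMod.unitsMap hcf α : ZMod c) *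
    (Real.logb 2 ‖1 - ZMod.stdAddChar (ZMod.unitsMap hmf α : ZMod m)‖ : ℂ)
  -- Translation by `k` fixes the logarithms and multiplies the character by `χ(k) ≠ 1`.
  have hT : T = χ (ZMod.unitsMap hcf k : ZMod c) * T := by
    rw [Finset.mul_sum]
    change ∑ _, _ = _
    rw [← Equiv.sum_comp (Equiv.mulLeft k)]
    refine Finset.sum_congr rfl fun α _ => ?_
    rw [Equiv.coe_mulLeft, map_mul, map_mul, MonoidHom.mem_ker.1 hk, one_mul, Units.val_mul,
      map_mul, mul_assoc]
  have hT0 : T = 0 := by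
    by_contra hT0
    exact hne (mul_right_cancel₀ hT0 (by rw [← hT, one_mul]))
  rw [hT0] at h
  exact (mul_eq_zero.1 h).resolve_left two_ne_zero

theorem norm_charEval_Log (hζ : IsPrimitiveRoot ζ f) (hc : 1 < c) (hf : 2 < f) (hcf : c ∣ f)
    {χ : DirichletCharacter ℂ c} (hχ : χ.IsPrimitive) (heven : χ.Even) {m : ℕ} [NeZero m]
    [NeZero c] (hmf : m ∣ f) (hcop : (f / m).Coprime m) (hcm : c ∣ m) :
    ‖charEval hcf χ heven (Log hζ (ζ ^ (f / m) - 1))‖ =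
      ((f / m).totient : ℝ) * √(c : ℝ) / (2 * Real.log 2) *
        (∏ p ∈ m.primeFactors, ‖1 - χ (p : ZMod c)‖) * ‖χ.LFunction 1‖ := by
  have h := two_mul_charEval_Log hζ hf hcf χ heven (ζ ^ (f / m) - 1)
  simp only [norm_sigma_zeta_pow_sub_one hζ hmf] at h
  have hlog : (0 : ℝ) < Real.log 2 := Real.log_pos one_lt_two
  have hval (u : (ZMod m)ˣ) : χ (ZMod.unitsMap hcm u : ZMod c) *
      (Real.logb 2 ‖1 - ZMod.stdAddChar (u : ZMod m)‖ : ℂ) =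
      χ ((u : ZMod m).val : ZMod c) *
        (logNormOneSubExp (((u : ZMod m).val : ℝ) / m) : ℂ) / Real.log 2 := by
    rw [logNormOneSubExp_natCast_div, ZMod.natCast_zmod_val, ZMod.unitsMap_val, ZMod.natCast_val,
      Real.logb, Complex.ofReal_div, mul_div_assoc]
  have hsum := MonoidHom.sum_comp_of_surjective (ZMod.unitsMap_surjective hmf)
    fun u => χ (ZMod.unitsMap hcm u : ZMod c) *
      (Real.logb 2 ‖1 - ZMod.stdAddChar (u : ZMod m)‖ : ℂ)
  rw [Finset.sum_congr rfl fun u _ => hval u, ZMod.card_ker_unitsMap hmf hcop, ← Finset.sum_div,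
    ZMod.sum_units_eq_sum_range fun i => χ (i : ZMod c) * (logNormOneSubExp ((i : ℝ) / m) : ℂ),
    χ.sum_range_coprime_logNormOneSubExp hc (NeZero.pos m) hcm,
    ← ZMod.sum_eq_sum_range fun i => χ (i : ZMod c) * (logNormOneSubExp ((i : ℝ) / c) : ℂ)] at hsum
  simp only [logNormOneSubExp_natCast_div, ZMod.natCast_zmod_val] at hsum
  have hcomp (α : (ZMod f)ˣ) :
      ZMod.unitsMap hcf α = ZMod.unitsMap hcm (ZMod.unitsMap hmf α) := by
    rw [← MonoidHom.comp_apply, ZMod.unitsMap_comp]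
  have hsum' : ∑ α : (ZMod f)ˣ, χ (ZMod.unitsMap hcf α : ZMod c) *
      (Real.logb 2 ‖1 - ZMod.stdAddChar (ZMod.unitsMap hmf α : ZMod m)‖ : ℂ) = _ :=
    (Finset.sum_congr rfl fun α _ => by rw [hcomp]).trans hsum
  rw [hsum'] at h
  have h2 := congr_arg norm h
  rw [nsmul_eq_mul, norm_mul, norm_mul, norm_div, norm_mul, heven.norm_sum_mul_log hc.ne' hχ,
    norm_prod, Complex.norm_natCast, Complex.norm_real, Real.norm_of_nonneg hlog.le,
    Complex.norm_two] at h2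
  field_simp at h2 ⊢
  linear_combination h2

end CycloLog

theorem mainTheorem3 (f : ℕ) [NeZero f]
    {K : Type*} [Field K] [CharZero K] [IsCyclotomicExtension {f} ℚ K]
    {ζ : K} (hζ : IsPrimitiveRoot ζ f)
    (c : ℕ) [NeZero c] (hc : 1 < c) (hcf : c ∣ f)
    (χ : DirichletCharacter ℂ c) (hχ : χ.IsPrimitive) (heven : χ.Even)
    (e : ℕ) (he : e ∈ CycloLog.Q f) :
    (Nat.Coprime c e →
      ‖CycloLog.charEval hcf χ heven (CycloLog.Log hζ (ζ ^ e - 1))‖ =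
        (Nat.totient e : ℝ) * √(c : ℝ) / (2 * Real.log 2) *
          (∏ p ∈ f.primeFactors with p ∣ f / e, ‖1 - χ (p : ZMod c)‖) *
          ‖DirichletCharacter.LFunction χ 1‖) ∧
    (¬ Nat.Coprime c e →
      ‖CycloLog.charEval hcf χ heven (CycloLog.Log hζ (ζ ^ e - 1))‖ = 0) := by
  have hf0 : f ≠ 0 := NeZero.ne f
  obtain ⟨hef, hcop⟩ := CycloLog.dvd_and_coprime_of_mem_Q hf0 he
  have hf : 2 < f := (hχ.two_lt hc).trans_le (Nat.le_of_dvd (NeZero.pos f) hcf)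
  have hmf : f / e ∣ f := Nat.div_dvd_of_dvd hef
  have hfm : f / (f / e) = e := Nat.div_div_self hef hf0
  have : NeZero (f / e) := ⟨ne_zero_of_dvd_ne_zero hf0 hmf⟩
  constructor
  · intro hce
    -- Since `e` and `f / e` are coprime and `c ∣ f`, the case split on `gcd(c, e)` is the split on
    -- `c ∣ f / e`.
    have hcm : c ∣ f / e := hce.dvd_of_dvd_mul_left (by rwa [Nat.mul_div_cancel' hef])
    have h := CycloLog.norm_charEval_Log hζ hc hf hcf hχ heven hmf (by rwa [hfm]) hcm
    have hP : {p ∈ f.primeFactors | p ∣ f / e} = (f / e).primeFactors := by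
      ext p
      simp only [Finset.mem_filter, Nat.mem_primeFactors]
      exact ⟨fun h => ⟨h.1.1, h.2, NeZero.ne _⟩, fun h => ⟨⟨h.1, h.2.1.trans hmf, hf0⟩, h.2.1⟩⟩
    rwa [hfm, ← hP] at h
  · intro hce
    have hcm : ¬ c ∣ f / e := fun h => hce (Nat.Coprime.coprime_dvd_left h hcop.symm)
    have h := CycloLog.charEval_Log_eq_zero hζ hf hcf hχ heven hmf hcm
    rw [hfm] at h
    rw [h, norm_zero]
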